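/- Let $\mathbb H$ be the real quaternion algebra with units $\mathbf i,\mathbf j,\mathbf k$, and let $r(M)$ denote the rank of a quaternion matrix $M$ (the dimension of its right column space). For $\eta\in\{\mathbf i,\mathbf j,\mathbf k\}$ put $M^{\eta*}=-\eta M^{*}\eta$, where $M^*$ is the conjugate transpose, and call a square matrix $M$ $\eta$-Hermitian if $M=M^{\eta*}$. **Theorem.** Let $A_i\in\mathbb H^{p_i\times s_i}$, $C_i\in\mathbb H^{p_i\times s_{i+1}}$, and let $E_i\in\mathbb H^{p_i\times p_i}$ be $\eta$-Hermitian, $i=1,\dots,k$. There are $\eta$-Hermitian matrices $X_j\in\mathbb H^{s_j\times s_j}$, $j=1,\dots,k+1$, with $$A_iX_iA_i^{\eta*}+C_iX_{i+1}C_i^{\eta*}=E_i,\qquad i=1,\dots,k,$$ if and only if the following $k(k+1)$ rank equalities hold for all $i=1,\dots,k$ and all $1\le m<n\le k$: $$r\begin{pmatrix}A_i&E_i&C_i\end{pmatrix}=r\begin{pmatrix}A_i&C_i\end{pmatrix},\qquad r\begin{pmatrix}A_i&E_i\\0&C_i^{\eta*}\end{pmatrix}=r(A_i)+r(C_i),$$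 $$r\begin{pmatrix}A_m&E_m&C_m\\&C_m^{\eta*}&&A_{m+1}^{\eta*}\\&&A_{m+1}&-E_{m+1}&C_{m+1}\\&&&\ddots&\ddots&\ddots\\&&&&A_n&(-1)^{n-m}E_n&C_n\end{pmatrix} =r\begin{pmatrix}A_m&C_m\\&A_{m+1}&C_{m+1}\\&&\ddots&\ddots\\&&&A_n&C_n\end{pmatrix}+r\begin{pmatrix}C_m\\A_{m+1}&C_{m+1}\\&A_{m+2}&\ddots\\&&\ddots&C_{n-1}\\&&&A_n\end{pmatrix},$$ $$r\begin{pmatrix}A_m&E_m&C_m\\&C_m^{\eta*}&&A_{m+1}^{\eta*}\\&&A_{m+1}&-E_{m+1}&\ddots\\&&&C_{m+1}^{\eta*}&\ddots&A_n^{\eta*}\\&&&&\ddots&(-1)^{n-m}E_n\\&&&&&C_n^{\eta*}\end{pmatrix} =r\begin{pmatrix}A_m&C_m\\&A_{m+1}&C_{m+1}\\&&\ddots&\ddots\\&&&A_{n-1}&C_{n-1}\\&&&&A_n\end{pmatrix}+r\begin{pmatrix}C_m\\A_{m+1}&C_{m+1}\\&A_{m+2}&C_{m+2}\\&&\ddots&\ddots\\&&&A_n&C_n\end{pmatrix},$$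 where blank entries are zero. -/

import Mathlib

open scoped Quaternion Matrix

noncomputable section

/-- The quaternion unit `𝐢`. -/
def quatI : ℍ[ℝ] := ⟨0, 1, 0, 0⟩

/-- The quaternion unit `𝐣`. -/
def quatJ : ℍ[ℝ] := ⟨0, 0, 1, 0⟩

/-- The quaternion unit `𝐤`. -/
def quatK : ℍ[ℝ] := ⟨0, 0, 0, 1⟩

/-- The rank of a quaternion matrix: the dimension of its column space as a right `ℍ`-vector
space (right `ℍ`-modules are modules over `ℍᵐᵒᵖ`). Mathlib's `Matrix.rank` is restricted to
commutative scalars. -/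
def quatRank {m n : Type*} (M : Matrix m n ℍ[ℝ]) : ℕ :=
  Module.finrank (ℍ[ℝ])ᵐᵒᵖ (Submodule.span (ℍ[ℝ])ᵐᵒᵖ (Set.range M.col))

/-- `A^{η*} = -η A* η`, where `A*` is the conjugate transpose. -/
def etaStar {m n : Type*} (η : ℍ[ℝ]) (A : Matrix m n ℍ[ℝ]) : Matrix n m ℍ[ℝ] :=
  Aᴴ.map fun q => -η * q * η

/-- `A` is `η`-Hermitian: `A = A^{η*}`. -/
def IsEtaHermitian {n : Type*} (η : ℍ[ℝ]) (A : Matrix n n ℍ[ℝ]) : Prop :=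
  A = etaStar η A

variable {k : ℕ} {p : Fin k → ℕ} {s : Fin (k + 1) → ℕ}

/-- The `(i, j)` block of the block bidiagonal matrix which in block row `i` has `A i` in block
column `i`, `C i` in block column `i + 1`, and zeros elsewhere. -/
def bidiagBlock
    (A : ∀ i : Fin k, Matrix (Fin (p i)) (Fin (s i.castSucc)) ℍ[ℝ])
    (C : ∀ i : Fin k, Matrix (Fin (p i)) (Fin (s i.succ)) ℍ[ℝ])
    (i : Fin k) (j : Fin (k + 1)) : Matrix (Fin (p i)) (Fin (s j)) ℍ[ℝ] :=
  if h : j = i.castSucc then (A i).submatrix id (Fin.cast (congrArg s h))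
  else if h : j = i.succ then (C i).submatrix id (Fin.cast (congrArg s h))
  else 0

/-- The part of the block bidiagonal matrix with block rows `i ∈ I` and block columns `j ∈ J`.
For instance, for `I = {m, …, n}` and `J = {m, …, n + 1}` it is
```
A_m  C_m
     A_{m+1}  C_{m+1}
              ⋱        ⋱
                       A_n  C_n
```
and for `J = {m + 1, …, n}` its first block column `A_m` and its last one `C_n` are missing. -/
def bidiag
    (A : ∀ i : Fin k, Matrix (Fin (p i)) (Fin (s i.castSucc)) ℍ[ℝ])
    (C : ∀ i : Fin k, Matrix (Fin (p i)) (Fin (s i.succ)) ℍ[ℝ])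
    (I : Finset (Fin k)) (J : Finset (Fin (k + 1))) :
    Matrix (Σ i : I, Fin (p i)) (Σ j : J, Fin (s j)) ℍ[ℝ] :=
  Matrix.of fun x y => bidiagBlock A C x.1 y.1 x.2 y.2

/-- The block diagonal matrix `diag(E_m, -E_{m+1}, …, (-1)^{n-m} E_n)`. -/
def signedDiag (E : ∀ i : Fin k, Matrix (Fin (p i)) (Fin (p i)) ℍ[ℝ]) (m n : Fin k) :
    Matrix (Σ i : Finset.Icc m n, Fin (p i)) (Σ i : Finset.Icc m n, Fin (p i)) ℍ[ℝ] :=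
  Matrix.blockDiagonal' fun i : Finset.Icc m n =>
    (-1 : ℝ) ^ (((i : Fin k) : ℕ) - (m : ℕ)) • E i

/-- The staircase matrix with the blocks
```
bidiag A C on rows {m, …, n}, columns J       diag(E_m, …, (-1)^{n-m} E_n)
0                                            (bidiag A C on rows {m, …, n}, columns J')^{η*}
```
so that `A_i`, `± E_i`, `C_i` stand in one block row for `m ≤ i ≤ n` (as far as the columns of
`A_i`, `C_i` are in `J`), and the block row `i + 1 ∈ J'` of the lower part has `C_i^{η*}` below
`± E_i` and `A_{i+1}^{η*}` below `± E_{i+1}`. In print the block rows of the upper and lower part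
alternate, and so do the block columns of the left and right part:
```
A_m  E_m        C_m
     C_m^{η*}            A_{m+1}^{η*}
                A_{m+1}  -E_{m+1}         C_{m+1}
                         C_{m+1}^{η*}              ⋱
```
The order of the blocks is immaterial for a matrix indexed by labelled blocks. -/
def staircase (η : ℍ[ℝ])
    (A : ∀ i : Fin k, Matrix (Fin (p i)) (Fin (s i.castSucc)) ℍ[ℝ])
    (C : ∀ i : Fin k, Matrix (Fin (p i)) (Fin (s i.succ)) ℍ[ℝ])
    (E : ∀ i : Fin k, Matrix (Fin (p i)) (Fin (p i)) ℍ[ℝ])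
    (m n : Fin k) (J J' : Finset (Fin (k + 1))) :
    Matrix ((Σ i : Finset.Icc m n, Fin (p i)) ⊕ (Σ j : J', Fin (s j)))
      ((Σ j : J, Fin (s j)) ⊕ (Σ i : Finset.Icc m n, Fin (p i))) ℍ[ℝ] :=
  Matrix.fromBlocks (bidiag A C (Finset.Icc m n) J) (signedDiag E m n)
    0 (etaStar η (bidiag A C (Finset.Icc m n) J'))

end

/-!
Since `q ↦ -η q* η` is an involution of `ℍ`, the theorem concerns a chain of equations
`A i * X i * (A i)ᴴ + C i * X (i + 1) * (C i)ᴴ = E i` over a division ring with involution in which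
`2 ≠ 0`, and averaging a solution with its conjugate transpose makes it Hermitian.

Regard the matrices as linear maps. The equations before node `j` act on `X j` through linear
relations from which `X j` has to select, and these relations form a chain for inclusion. Extending
a selector of each relation to the next larger one yields a common selector, so the unknowns can be
chosen one after another, the last one first. What remains is a condition on each segment of the
chain, with either end free or held at zero: compatible vectors must lift to values of the unknowns.

A block triangular matrix with diagonal blocks `N`, `N'` and corner `F` has rank `r(N) + r(N')` if
and only if `F` maps the kernel of `N'` into the range of `N`. For the staircase matrices this is
the segment condition, since the signs of the `E i` turn `(A i)ᴴ x i + (C (i - 1))ᴴ x (i - 1) = 0`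
into compatibility. Conjugate transposition interchanges free and fixed ends, so two of the four
choices of end conditions suffice.
-/

section Selectors

variable {K W V : Type*} [DivisionRing K] [AddCommGroup W] [Module K W] [AddCommGroup V]
  [Module K V]

/-- `g` selects from the linear relation `R`: it sends every `w` in the domain of `R` to an element
related to `w`. -/
def IsSelector (R : Submodule K (W × V)) (g : W →ₗ[K] V) : Prop :=
  ∀ ⦃w v⦄, (w, v) ∈ R → (w, g w) ∈ R

theorem exists_isSelector (R : Submodule K (W × V)) : ∃ g, IsSelector R g := by
  let π : R →ₗ[K] W := LinearMap.fst K W V ∘ₗ R.subtype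
  obtain ⟨σ, hσ⟩ := π.rangeRestrict.exists_rightInverse_of_surjective π.range_rangeRestrict
  obtain ⟨g, hg⟩ := LinearMap.exists_extend (LinearMap.snd K W V ∘ₗ R.subtype ∘ₗ σ)
  refine ⟨g, fun w v hwv => ?_⟩
  let x : LinearMap.range π := ⟨w, ⟨(w, v), hwv⟩, rfl⟩
  have hfst : (σ x : W × V).1 = w := congrArg Subtype.val (LinearMap.congr_fun hσ x)
  have hsnd : g w = (σ x : W × V).2 := LinearMap.congr_fun hg x
  have hσx : (w, g w) = (σ x : W × V) := Prod.ext hfst.symm hsnd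
  exact hσx ▸ (σ x).2

theorem exists_eqOn_eqOn_of_disjoint {P Q : Submodule K W} (h : Disjoint P Q) (f g : W →ₗ[K] V) :
    ∃ l : W →ₗ[K] V, Set.EqOn l f P ∧ Set.EqOn l g Q := by
  obtain ⟨P', hP, hc⟩ := h.exists_isCompl
  refine ⟨LinearMap.ofIsCompl hc (f.domRestrict P') (g.domRestrict Q), fun w hw => ?_,
    fun w hw => ?_⟩
  · exact LinearMap.ofIsCompl_apply_left hc ⟨w, hP hw⟩
  · exact LinearMap.ofIsCompl_apply_right hc ⟨w, hw⟩

theorem exists_isSelector_eqOn (R : Submodule K (W × V)) (P : Submodule K W) (f : W →ₗ[K] V)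
    (hf : ∀ w ∈ P, ∀ v, (w, v) ∈ R → (w, f w) ∈ R) :
    ∃ g : W →ₗ[K] V, Set.EqOn g f P ∧ IsSelector R g := by
  let S := R.map (LinearMap.fst K W V)
  obtain ⟨S', hdisj, hsup⟩ :=
    IsModularLattice.exists_disjoint_and_sup_eq (inf_le_right : P ⊓ S ≤ S)
  have hS' : S' ≤ S := hsup ▸ le_sup_right
  have hPS' : Disjoint P S' := by
    rw [disjoint_iff] at hdisj ⊢
    rwa [inf_assoc, inf_eq_right.2 hS'] at hdisj
  obtain ⟨g₀, hg₀⟩ := exists_isSelector R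
  obtain ⟨g, hgP, hgS'⟩ := exists_eqOn_eqOn_of_disjoint hPS' f g₀
  refine ⟨g, hgP, fun w v hwv => ?_⟩
  have hw : w ∈ P ⊓ S ⊔ S' := hsup.ge ⟨_, hwv, rfl⟩
  obtain ⟨a, ⟨haP, ⟨⟨_, c⟩, hac, rfl⟩⟩, b, hb, rfl⟩ := Submodule.mem_sup.1 hw
  obtain ⟨⟨_, d⟩, hbd, rfl⟩ := hS' hb
  have ha := hf _ haP c hac
  rw [← hgP haP] at ha
  have hb' := hg₀ hbd
  rw [LinearMap.fst_apply] at hb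
  rw [← hgS' hb] at hb'
  simpa using R.add_mem ha hb'

theorem exists_common_isSelector_eqOn {L : List (Submodule K (W × V))} (hL : L.Pairwise (· ≤ ·))
    (P : Submodule K W) (f : W →ₗ[K] V)
    (hf : ∀ R ∈ L, ∀ w ∈ P, ∀ v, (w, v) ∈ R → (w, f w) ∈ R) :
    ∃ g : W →ₗ[K] V, Set.EqOn g f P ∧ ∀ R ∈ L, IsSelector R g := by
  induction L generalizing P f with
  | nil => exact ⟨f, fun _ _ => rfl, by simp⟩
  | cons R L ih =>
    obtain ⟨hR, hL⟩ := List.pairwise_cons.1 hL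
    obtain ⟨h, hP, hS⟩ := exists_isSelector_eqOn R P f (hf R (by simp))
    have hext : ∀ R' ∈ L, ∀ w ∈ P ⊔ R.map (LinearMap.fst K W V), ∀ v,
        (w, v) ∈ R' → (w, h w) ∈ R' := by
      intro R' hR' w hw v hv
      obtain ⟨a, ha, b, ⟨⟨b, c⟩, hbc, rfl⟩, rfl⟩ := Submodule.mem_sup.1 hw
      have hb : (b, h b) ∈ R' := hR R' hR' (hS hbc)
      have hac : (a, v - c) ∈ R' := by simpa using R'.sub_mem hv (hR R' hR' hbc)
      have ha' : (a, h a) ∈ R' := (hP ha).symm ▸ hf R' (by simp [hR']) a ha _ hac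
      simpa using R'.add_mem ha' hb
    obtain ⟨g, hg, hgL⟩ := ih hL _ h hext
    refine ⟨g, fun w hw => (hg (Submodule.mem_sup_left hw)).trans (hP hw), ?_⟩
    rintro R' hR' w v hv
    rcases List.mem_cons.1 hR' with rfl | hR'
    · have hgw : g w = h w := hg (Submodule.mem_sup_right ⟨_, hv, rfl⟩)
      exact hgw ▸ hS hv
    · exact hgL R' hR' hv

theorem exists_common_isSelector {L : List (Submodule K (W × V))} (hL : L.Pairwise (· ≤ ·)) :
    ∃ g : W →ₗ[K] V, ∀ R ∈ L, IsSelector R g := by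
  obtain ⟨g, -, hg⟩ := exists_common_isSelector_eqOn hL ⊥ 0
    fun R _ w hw _ _ => (Submodule.mem_bot K).1 hw ▸ R.zero_mem
  exact ⟨g, hg⟩

end Selectors

section OneEquation

variable {K U U' V V' : Type*} [DivisionRing K] [AddCommGroup U] [Module K U] [AddCommGroup U']
  [Module K U'] [AddCommGroup V] [Module K V] [AddCommGroup V'] [Module K V']

theorem exists_common_isSelector_comp_eq {A : V →ₗ[K] U} {B : U' →ₗ[K] V'} {Y : U' →ₗ[K] U}
    {L : List (Submodule K (V' × V))} (hL : L.Pairwise (· ≤ ·)) (hbot : ⊥ ∈ L) (htop : ⊤ ∈ L)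
    (hY : ∀ R ∈ L, ∀ u v, (B u, v) ∈ R → ∃ v', (B u, v') ∈ R ∧ A v' = Y u) :
    ∃ X : V' →ₗ[K] V, (∀ R ∈ L, IsSelector R X) ∧ A ∘ₗ X ∘ₗ B = Y := by
  have hker : ∀ u, B u = 0 → Y u = 0 := fun u hu => by
    obtain ⟨v, hv, hvu⟩ := hY ⊥ hbot u 0 (by simp [hu])
    obtain ⟨-, rfl⟩ : B u = 0 ∧ v = 0 := by simpa using hv
    simpa using hvu.symm
  let G : Submodule K (V' × V) := (LinearMap.eqLocus (A ∘ₗ LinearMap.snd K U' V)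
    (Y ∘ₗ LinearMap.fst K U' V)).map (B.prodMap LinearMap.id)
  have hG : ∀ u v, (B u, v) ∈ G ↔ A v = Y u := by
    refine fun u v => ⟨?_, fun h => ⟨(u, v), h, rfl⟩⟩
    rintro ⟨⟨u', v'⟩, h, h'⟩
    obtain ⟨hB, rfl⟩ : B u' = B u ∧ v' = v := by simpa using h'
    have hYu : Y u' = Y u := by
      simpa [sub_eq_zero] using hker (u' - u) (by simp [hB])
    exact h.trans hYu
  obtain ⟨f, hf⟩ := exists_common_isSelector (L := L.map (· ⊓ G))
    (hL.map _ fun _ _ h => inf_le_inf_right G h)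
  have hfB : ∀ R ∈ L, ∀ u v, (B u, v) ∈ R → (B u, f (B u)) ∈ R ⊓ G := by
    intro R hR u v hv
    obtain ⟨v', hv', hAv'⟩ := hY R hR u v hv
    exact hf _ (List.mem_map_of_mem hR) ⟨hv', (hG u v').2 hAv'⟩
  obtain ⟨X, hX, hXL⟩ := exists_common_isSelector_eqOn hL (LinearMap.range B) f (by
    rintro R hR _ ⟨u, rfl⟩ v hv
    exact (hfB R hR u v hv).1)
  refine ⟨X, hXL, LinearMap.ext fun u => ?_⟩
  rw [LinearMap.comp_apply, LinearMap.comp_apply, hX ⟨u, rfl⟩, ← hG]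
  exact (hfB ⊤ htop u 0 trivial).2

/-- The relation that `R` and the equation `E = A ∘ X ∘ B + C ∘ X₁ ∘ D` for a selector `X` of `R`
impose on `X₁`. -/
def transfer (A : V →ₗ[K] U) (B : U' →ₗ[K] V') {V₁ V₁' : Type*} [AddCommGroup V₁] [Module K V₁]
    [AddCommGroup V₁'] [Module K V₁'] (C : V₁ →ₗ[K] U) (D : U' →ₗ[K] V₁') (E : U' →ₗ[K] U)
    (R : Submodule K (V' × V)) : Submodule K (V₁' × V₁) where
  carrier := {w | ∃ u v, D u = w.1 ∧ (B u, v) ∈ R ∧ E u = A v + C w.2}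
  zero_mem' := ⟨0, 0, by simp [← Prod.zero_eq_mk]⟩
  add_mem' := by
    rintro ⟨_, w⟩ ⟨_, w'⟩ ⟨u, v, rfl, hv, h⟩ ⟨u', v', rfl, hv', h'⟩
    refine ⟨u + u', v + v', map_add D u u', by simpa using R.add_mem hv hv', ?_⟩
    simp only [map_add, h, h', Prod.snd_add, add_add_add_comm]
  smul_mem' := by
    rintro c ⟨_, w⟩ ⟨u, v, rfl, hv, h⟩
    refine ⟨c • u, c • v, map_smul D c u, by simpa using R.smul_mem c hv, ?_⟩
    simp only [map_smul, h, Prod.smul_snd, smul_add]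

variable {V₁ V₁' : Type*} [AddCommGroup V₁] [Module K V₁] [AddCommGroup V₁'] [Module K V₁']
  {A : V →ₗ[K] U} {B : U' →ₗ[K] V'} {C : V₁ →ₗ[K] U} {D : U' →ₗ[K] V₁'} {E : U' →ₗ[K] U}

theorem transfer_mono : Monotone (transfer A B C D E) :=
  fun _ _ h _ ⟨u, v, hu, hv, huv⟩ => ⟨u, v, hu, h hv, huv⟩

theorem exists_eq_sub_of_isSelector_transfer {R : Submodule K (V' × V)} {X₁ : V₁' →ₗ[K] V₁}
    (hX₁ : IsSelector (transfer A B C D E R) X₁)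
    (hker : ∀ u v, D u = 0 → (B u, v) ∈ R → ∃ v', (B u, v') ∈ R ∧ E u = A v')
    (hrange : ∀ u v, (B u, v) ∈ R → ∃ v' v₁, (B u, v') ∈ R ∧ E u = A v' + C v₁)
    (u : U') (v : V) (hv : (B u, v) ∈ R) :
    ∃ v', (B u, v') ∈ R ∧ A v' = E u - C (X₁ (D u)) := by
  obtain ⟨a, a₁, ha, hEa⟩ := hrange u v hv
  obtain ⟨u', b, hDu', hb, hEu'⟩ := hX₁ ⟨u, a, rfl, ha, hEa⟩
  obtain ⟨c, hc, hEc⟩ := hker (u - u') (a - b) (by simp [hDu'])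
    (by simpa using R.sub_mem ha hb)
  refine ⟨b + c, by simpa using R.add_mem hb hc, ?_⟩
  rw [map_add, ← hEc, map_sub, hEu']
  abel

end OneEquation

section Zigzag

variable {K : Type*} [DivisionRing K] {k : ℕ} {U U' : Fin k → Type*} {V V' : Fin (k + 1) → Type*}
  [∀ i, AddCommGroup (U i)] [∀ i, Module K (U i)] [∀ i, AddCommGroup (U' i)]
  [∀ i, Module K (U' i)] [∀ j, AddCommGroup (V j)] [∀ j, Module K (V j)]
  [∀ j, AddCommGroup (V' j)] [∀ j, Module K (V' j)]

/-- The solvability condition on the segment of the chain from node `l` to node `r`, with end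
conditions `R` and `S`: a compatible family of vectors `x i`, with `B i (x i)` and `D i (x i)` equal
to `z` at the two ends of the edge `i`, has values `v` (in a solution, `v j = X j (z j)`) that
satisfy all equations of the segment and the end conditions, provided that each of the two end
conditions can be satisfied. -/
def LiftsZigzags (A : ∀ i : Fin k, V i.castSucc →ₗ[K] U i)
    (C : ∀ i : Fin k, V i.succ →ₗ[K] U i) (B : ∀ i : Fin k, U' i →ₗ[K] V' i.castSucc)
    (D : ∀ i : Fin k, U' i →ₗ[K] V' i.succ) (E : ∀ i : Fin k, U' i →ₗ[K] U i)
    (l r : Fin (k + 1)) (R : Submodule K (V' l × V l)) (S : Submodule K (V' r × V r)) : Prop :=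
  ∀ (x : ∀ i, U' i) (z : ∀ j, V' j),
    (∀ i, l ≤ i.castSucc → i.succ ≤ r → B i (x i) = z i.castSucc ∧ D i (x i) = z i.succ) →
    (∃ v, (z l, v) ∈ R) → (∃ v, (z r, v) ∈ S) →
    ∃ v : ∀ j, V j, (z l, v l) ∈ R ∧ (z r, v r) ∈ S ∧
      ∀ i, l ≤ i.castSucc → i.succ ≤ r → E i (x i) = A i (v i.castSucc) + C i (v i.succ)

/-- The two end conditions of interest: an end is free (`⊤`) or held at zero (`⊥`). -/
def endRelation (K : Type*) {V V' : Type*} [DivisionRing K] [AddCommGroup V] [Module K V]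
    [AddCommGroup V'] [Module K V'] (a : Bool) : Submodule K (V' × V) :=
  bif a then ⊤ else ⊥

@[simp]
theorem mem_endRelation {V V' : Type*} [AddCommGroup V] [Module K V] [AddCommGroup V'] [Module K V']
    {a : Bool} {w : V'} {v : V} : (w, v) ∈ endRelation K a ↔ (a = false → w = 0 ∧ v = 0) := by
  cases a <;> simp [endRelation]

variable {A : ∀ i : Fin k, V i.castSucc →ₗ[K] U i} {C : ∀ i : Fin k, V i.succ →ₗ[K] U i}
  {B : ∀ i : Fin k, U' i →ₗ[K] V' i.castSucc} {D : ∀ i : Fin k, U' i →ₗ[K] V' i.succ}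
  {E : ∀ i : Fin k, U' i →ₗ[K] U i}

theorem exists_family_castSucc_succ (i : Fin k) (a : V i.castSucc) (b : V i.succ) :
    ∃ v : ∀ j, V j, v i.castSucc = a ∧ v i.succ = b :=
  ⟨Function.update (Function.update 0 i.succ b) i.castSucc a, by simp,
    by simp [Function.update_of_ne i.castSucc_lt_succ.ne']⟩

theorem liftsZigzags_castSucc_succ_iff (i : Fin k) {R : Submodule K (V' i.castSucc × V i.castSucc)}
    {S : Submodule K (V' i.succ × V i.succ)} :
    LiftsZigzags A C B D E i.castSucc i.succ R S ↔
      ∀ u, (∃ v, (B i u, v) ∈ R) → (∃ w, (D i u, w) ∈ S) →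
        ∃ v w, (B i u, v) ∈ R ∧ (D i u, w) ∈ S ∧ E i u = A i v + C i w := by
  have hedge : ∀ i' : Fin k, i.castSucc ≤ i'.castSucc → i'.succ ≤ i.succ → i' = i :=
    fun i' h h' => le_antisymm (Fin.succ_le_succ_iff.1 h') (Fin.castSucc_le_castSucc_iff.1 h)
  constructor
  · intro h u hR hS
    obtain ⟨z, hz, hz'⟩ := exists_family_castSucc_succ i (B i u) (D i u)
    obtain ⟨v, hvR, hvS, hE⟩ := h (Pi.single i u) z
      (fun i' h₁ h₂ => by obtain rfl := hedge i' h₁ h₂; simp [hz, hz'])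
      (hz.symm ▸ hR) (hz'.symm ▸ hS)
    exact ⟨v i.castSucc, v i.succ, hz ▸ hvR, hz' ▸ hvS, by simpa using hE i le_rfl le_rfl⟩
  · intro h x z hx hR hS
    obtain ⟨hB, hD⟩ := hx i le_rfl le_rfl
    obtain ⟨a, b, ha, hb, hE⟩ := h (x i) (hB.symm ▸ hR) (hD.symm ▸ hS)
    obtain ⟨v, rfl, rfl⟩ := exists_family_castSucc_succ i a b
    exact ⟨v, hB ▸ ha, hD ▸ hb, fun i' h₁ h₂ => by obtain rfl := hedge i' h₁ h₂; exact hE⟩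

theorem LiftsZigzags.transfer {i : Fin k} {r : Fin (k + 1)} (hr : i.succ ≤ r)
    {R : Submodule K (V' i.castSucc × V i.castSucc)} {S : Submodule K (V' r × V r)}
    (h : LiftsZigzags A C B D E i.castSucc r R S) :
    LiftsZigzags A C B D E i.succ r (transfer (A i) (B i) (C i) (D i) (E i) R) S := by
  rintro x z hx ⟨_, u, v₀, hDu, hv₀, _⟩ hS
  have hir : r ≠ i.castSucc := (i.castSucc_lt_succ.trans_le hr).ne'
  have hx' : ∀ i', i.castSucc ≤ i'.castSucc → i'.succ ≤ r →
      B i' (Function.update x i u i') = Function.update z i.castSucc (B i u) i'.castSucc ∧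
        D i' (Function.update x i u i') = Function.update z i.castSucc (B i u) i'.succ := by
    intro i' hi' hr'
    obtain rfl | hlt := (Fin.castSucc_le_castSucc_iff.1 hi').eq_or_lt
    · simp [Function.update_of_ne i.castSucc_lt_succ.ne', hDu]
    · have hsucc : i'.succ ≠ i.castSucc :=
        ((Fin.castSucc_lt_castSucc_iff.2 hlt).trans i'.castSucc_lt_succ).ne'
      simpa [Function.update_of_ne, hlt.ne', hsucc] using hx i' (Fin.succ_le_castSucc_iff.2 hlt) hr'
  obtain ⟨v, hvR, hvS, hE⟩ := h (Function.update x i u) (Function.update z i.castSucc (B i u)) hx'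
    ⟨v₀, by simpa using hv₀⟩ (by simpa [Function.update_of_ne hir] using hS)
  refine ⟨v, ⟨u, v i.castSucc, hDu, by simpa using hvR, by simpa using hE i le_rfl hr⟩,
    by simpa [Function.update_of_ne hir] using hvS, fun i' hi' hr' => ?_⟩
  have hlt : i < i' := Fin.succ_le_castSucc_iff.1 hi'
  simpa [Function.update_of_ne hlt.ne'] using hE i' (Fin.castSucc_le_castSucc_iff.2 hlt.le) hr'

theorem exists_selectors_of_liftsZigzags (l : Fin (k + 1)) {L : List (Submodule K (V' l × V l))}
    (hL : L.Pairwise (· ≤ ·)) (hbot : ⊥ ∈ L) (htop : ⊤ ∈ L)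
    (hleft : ∀ R ∈ L, ∀ r, l < r → ∀ b, LiftsZigzags A C B D E l r R (endRelation K b))
    (hright : ∀ m r, l < m → m < r → ∀ a b,
      LiftsZigzags A C B D E m r (endRelation K a) (endRelation K b)) :
    ∃ X : ∀ j, V' j →ₗ[K] V j, (∀ R ∈ L, IsSelector R (X l)) ∧
      ∀ i, l ≤ i.castSucc → A i ∘ₗ X i.castSucc ∘ₗ B i + C i ∘ₗ X i.succ ∘ₗ D i = E i := by
  induction l using Fin.reverseInduction with
  | last =>
    obtain ⟨f, hf⟩ := exists_common_isSelector hL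
    refine ⟨Function.update 0 (Fin.last k) f, by simpa using hf, fun i hi => ?_⟩
    exact absurd i.castSucc_lt_last hi.not_gt
  | cast i ih =>
    let T := transfer (A i) (B i) (C i) (D i) (E i)
    have hLT : (⊥ :: (L.map T ++ [⊤])).Pairwise (· ≤ ·) := by
      simpa [List.pairwise_append] using hL.map T fun _ _ h => transfer_mono h
    obtain ⟨X, hXT, hX⟩ := ih hLT (by simp) (by simp) (by
      intro R hR r hr b
      simp only [List.mem_cons, List.mem_append, List.mem_map, List.not_mem_nil, or_false] at hR
      obtain rfl | ⟨R, hR, rfl⟩ | rfl := hR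
      · exact hright i.succ r i.castSucc_lt_succ hr false b
      · exact (hleft R hR r (i.castSucc_lt_succ.trans hr) b).transfer hr.le
      · exact hright i.succ r i.castSucc_lt_succ hr true b)
      fun m r hm => hright m r (i.castSucc_lt_succ.trans hm)
    have hedge : ∀ R ∈ L, ∀ b, _ := fun R hR b =>
      (liftsZigzags_castSucc_succ_iff i).1 (hleft R hR i.succ i.castSucc_lt_succ b)
    have hTL : ∀ R ∈ L, T R ∈ ⊥ :: (L.map T ++ [⊤]) := fun R hR =>
      List.mem_cons_of_mem _ (List.mem_append_left _ (List.mem_map_of_mem hR))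
    obtain ⟨X₀, hX₀, hX₀eq⟩ := exists_common_isSelector_comp_eq (A := A i) (B := B i)
      (Y := E i - C i ∘ₗ X i.succ ∘ₗ D i) hL hbot htop fun R hR =>
        exists_eq_sub_of_isSelector_transfer (hXT (T R) (hTL R hR))
          (fun u v hu hv => by simpa [hu] using hedge R hR false u ⟨v, hv⟩)
          (fun u v hv => by simpa using hedge R hR true u ⟨v, hv⟩)
    refine ⟨Function.update X i.castSucc X₀, by simpa using hX₀, fun i' hi' => ?_⟩
    obtain rfl | hlt := (Fin.castSucc_le_castSucc_iff.1 hi').eq_or_lt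
    · rw [Function.update_self, Function.update_of_ne i.castSucc_lt_succ.ne', hX₀eq, sub_add_cancel]
    · have hsucc : i'.succ ≠ i.castSucc :=
        ((Fin.castSucc_lt_castSucc_iff.2 hlt).trans i'.castSucc_lt_succ).ne'
      simpa [Function.update_of_ne, hlt.ne', hsucc] using hX i' (Fin.succ_le_castSucc_iff.2 hlt)

theorem exists_zigzag_solution_iff :
    (∃ X : ∀ j, V' j →ₗ[K] V j,
      ∀ i, A i ∘ₗ X i.castSucc ∘ₗ B i + C i ∘ₗ X i.succ ∘ₗ D i = E i) ↔
    ∀ l r, l < r → ∀ a b, LiftsZigzags A C B D E l r (endRelation K a) (endRelation K b) := by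
  constructor
  · rintro ⟨X, hX⟩ l r - a b x z hx hl hr
    have hend : ∀ j a, (∃ v, (z j, v) ∈ endRelation K (V := V j) a) →
        (z j, X j (z j)) ∈ endRelation K (V := V j) a := by
      rintro j a ⟨v, hv⟩
      simp +contextual [mem_endRelation.1 hv]
    refine ⟨fun j => X j (z j), hend l a hl, hend r b hr, fun i hi hi' => ?_⟩
    obtain ⟨hB, hD⟩ := hx i hi hi'
    simp [← hX, hB, hD]
  · intro h
    obtain ⟨X, -, hX⟩ := exists_selectors_of_liftsZigzags (A := A) (C := C) (B := B) (D := D)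
      (E := E) 0 (L := [⊥, ⊤]) (by simp) (by simp) (by simp)
      (fun R hR r hr => by
        obtain rfl | rfl : R = ⊥ ∨ R = ⊤ := by simpa using hR
        exacts [h 0 r hr false, h 0 r hr true])
      fun m r _ => h m r
    exact ⟨X, fun i => hX i (Fin.zero_le _)⟩

end Zigzag

section Rank

open MulOpposite

variable {K : Type*} [DivisionRing K] {l m n o : Type*}

/-- The rank of a matrix over a division ring: the dimension of its column space as a right vector
space. (`Matrix.rank` requires commutative scalars.) -/
noncomputable def rightRank (M : Matrix m n K) : ℕ :=
  Module.finrank Kᵐᵒᵖ (Submodule.span Kᵐᵒᵖ (Set.range M.col))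

/-- The right linear map `v ↦ M *ᵥ v`. -/
noncomputable def colMap [Fintype n] (M : Matrix m n K) : (n → K) →ₗ[Kᵐᵒᵖ] (m → K) :=
  Matrix.mulVecBilin K Kᵐᵒᵖ M

@[simp]
theorem colMap_apply [Fintype n] (M : Matrix m n K) (v : n → K) : colMap M v = M *ᵥ v := rfl

theorem exists_colMap_eq [Fintype n] (f : (n → K) →ₗ[Kᵐᵒᵖ] (m → K)) :
    ∃ M : Matrix m n K, colMap M = f := by
  classical
  refine ⟨Matrix.of fun i j => f (Pi.single j 1) i, LinearMap.pi_ext' fun j => ?_⟩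
  exact LinearMap.ext_ring_op (funext fun i => by simp)

theorem range_colMap [Fintype n] (M : Matrix m n K) :
    LinearMap.range (colMap M) = Submodule.span Kᵐᵒᵖ (Set.range M.col) := by
  classical
  refine le_antisymm ?_ (Submodule.span_le.2 ?_)
  · rintro _ ⟨v, rfl⟩
    rw [colMap_apply, Matrix.mulVec_eq_sum]
    exact Submodule.sum_mem _ fun j _ => Submodule.smul_mem _ _ (Submodule.subset_span ⟨j, rfl⟩)
  · rintro _ ⟨j, rfl⟩
    exact ⟨Pi.single j 1, by simp⟩

theorem rightRank_eq_finrank_range [Fintype n] (M : Matrix m n K) :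
    rightRank M = Module.finrank Kᵐᵒᵖ (LinearMap.range (colMap M)) := by
  rw [rightRank, range_colMap]

instance : Module.Finite Kᵐᵒᵖ K :=
  ⟨{1}, Submodule.eq_top_iff'.2 fun x => by
    simpa using Submodule.smul_mem _ (op x) (Submodule.subset_span (Set.mem_singleton (1 : K)))⟩

theorem finrank_sup_eq_left_iff {V : Type*} [AddCommGroup V] [Module K V] [Module.Finite K V]
    {S T : Submodule K V} : Module.finrank K ↥(S ⊔ T) = Module.finrank K S ↔ T ≤ S :=
  ⟨fun h => le_sup_right.trans (Submodule.eq_of_le_of_finrank_eq le_sup_left h.symm).ge,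
    fun h => by rw [sup_eq_left.2 h]⟩

theorem finrank_eq_finrank_comap_inl_add_finrank_map_snd {V W : Type*} [AddCommGroup V]
    [Module K V] [AddCommGroup W] [Module K W] [Module.Finite K V] [Module.Finite K W]
    (S : Submodule K (V × W)) :
    Module.finrank K S = Module.finrank K (S.comap (LinearMap.inl K V W)) +
      Module.finrank K (S.map (LinearMap.snd K V W)) := by
  let π : S →ₗ[K] W := LinearMap.snd K V W ∘ₗ S.subtype
  have hker : (LinearMap.ker π).map S.subtype =
      (S.comap (LinearMap.inl K V W)).map (LinearMap.inl K V W) := by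
    refine le_antisymm ?_ ?_
    · rintro _ ⟨⟨⟨v, _⟩, h⟩, rfl, rfl⟩
      exact ⟨v, h, rfl⟩
    · rintro _ ⟨v, h, rfl⟩
      exact ⟨⟨(v, 0), h⟩, rfl, rfl⟩
  rw [← LinearMap.finrank_range_add_finrank_ker π, add_comm, LinearMap.range_comp,
    Submodule.range_subtype, ← Submodule.finrank_map_subtype_eq, hker,
    ← (Submodule.equivMapOfInjective _ LinearMap.inl_injective _).finrank_eq]

theorem rightRank_fromBlocks_eq_iff [Finite m] [Fintype n] [Finite l] [Fintype o]
    (N : Matrix m n K) (F : Matrix m o K) (N' : Matrix l o K) :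
    rightRank (Matrix.fromBlocks N F 0 N') = rightRank N + rightRank N' ↔
      ∀ x, N' *ᵥ x = 0 → ∃ v, F *ᵥ x = N *ᵥ v := by
  let e := LinearEquiv.sumArrowLequivProdArrow m l Kᵐᵒᵖ K
  let S := (LinearMap.range (colMap (Matrix.fromBlocks N F 0 N'))).map e.toLinearMap
  have hS : ∀ y y', (y, y') ∈ S ↔ ∃ v x, N *ᵥ v + F *ᵥ x = y ∧ N' *ᵥ x = y' := by
    have he : ∀ x, e (Matrix.fromBlocks N F 0 N' *ᵥ x) =
        (N *ᵥ (x ∘ Sum.inl) + F *ᵥ (x ∘ Sum.inr), N' *ᵥ (x ∘ Sum.inr)) := fun x => by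
      simp only [Matrix.fromBlocks_mulVec, Matrix.zero_mulVec, zero_add]
      rfl
    intro y y'
    constructor
    · rintro ⟨_, ⟨x, rfl⟩, h⟩
      exact ⟨_, _, Prod.mk.inj ((he x).symm.trans h)⟩
    · rintro ⟨v, x, rfl, rfl⟩
      exact ⟨_, ⟨Sum.elim v x, rfl⟩, he _⟩
  have hsnd : S.map (LinearMap.snd Kᵐᵒᵖ _ _) = LinearMap.range (colMap N') := by
    ext y'
    simp [hS]
  have hinl : S.comap (LinearMap.inl Kᵐᵒᵖ _ _) =
      LinearMap.range (colMap N) ⊔ (LinearMap.ker (colMap N')).map (colMap F) := by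
    ext y
    simp only [Submodule.mem_comap, LinearMap.inl_apply, hS, Submodule.mem_sup,
      LinearMap.mem_range, Submodule.mem_map, LinearMap.mem_ker, colMap_apply]
    grind
  have hrank : rightRank (Matrix.fromBlocks N F 0 N') = Module.finrank Kᵐᵒᵖ S := by
    rw [rightRank_eq_finrank_range, LinearEquiv.finrank_map_eq]
  rw [hrank, finrank_eq_finrank_comap_inl_add_finrank_map_snd, hsnd, hinl,
    rightRank_eq_finrank_range, rightRank_eq_finrank_range, add_left_inj, finrank_sup_eq_left_iff,
    Submodule.map_le_iff_le_comap]
  simp [SetLike.le_def, eq_comm]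

theorem span_range_col_fromCols (M : Matrix m n K) (N : Matrix m o K) :
    Submodule.span Kᵐᵒᵖ (Set.range (Matrix.fromCols M N).col) =
      Submodule.span Kᵐᵒᵖ (Set.range M.col) ⊔ Submodule.span Kᵐᵒᵖ (Set.range N.col) := by
  have hcol : (Matrix.fromCols M N).col = Sum.elim M.col N.col := by
    ext1 (j | j) <;> rfl
  rw [hcol, Set.Sum.elim_range, Submodule.span_union]

theorem rightRank_fromCols_fromCols_eq_iff [Finite m] [Fintype n] [Fintype l] [Fintype o]
    (A : Matrix m n K) (E : Matrix m o K) (C : Matrix m l K) :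
    rightRank (Matrix.fromCols A (Matrix.fromCols E C)) = rightRank (Matrix.fromCols A C) ↔
      ∀ x, ∃ v w, E *ᵥ x = A *ᵥ v + C *ᵥ w := by
  rw [rightRank, rightRank, span_range_col_fromCols, span_range_col_fromCols,
    span_range_col_fromCols, sup_comm (Submodule.span _ (Set.range E.col)), ← sup_assoc,
    finrank_sup_eq_left_iff, ← range_colMap, ← range_colMap, ← range_colMap]
  simp [SetLike.le_def, Submodule.mem_sup, eq_comm]

theorem exists_rank_factorization [Finite m] (M : Matrix m n K) :
    ∃ (P : Matrix m (Fin (rightRank M)) K) (Q : Matrix (Fin (rightRank M)) n K), M = P * Q := by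
  let R := Submodule.span Kᵐᵒᵖ (Set.range M.col)
  let b := Module.finBasisOfFinrankEq Kᵐᵒᵖ R (rfl : _ = rightRank M)
  let c : n → R := fun j => ⟨M.col j, Submodule.subset_span ⟨j, rfl⟩⟩
  refine ⟨Matrix.of fun i r => (b r).1 i, Matrix.of fun r j => (b.repr (c j) r).unop, ?_⟩
  ext1 i j
  have h := congrFun (congrArg Subtype.val (b.sum_repr (c j))) i
  rw [Submodule.coe_sum, Finset.sum_apply] at h
  exact h.symm

theorem rightRank_mul_le_card [Finite m] [Finite n] [Fintype l] (P : Matrix m l K)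
    (Q : Matrix l n K) : rightRank (P * Q) ≤ Fintype.card l := by
  have := Fintype.ofFinite n
  have hrange : LinearMap.range (colMap (P * Q)) ≤ LinearMap.range (colMap P) := by
    rintro _ ⟨x, rfl⟩
    exact ⟨Q *ᵥ x, by simp⟩
  calc rightRank (P * Q) ≤ rightRank P := by
        simpa only [rightRank_eq_finrank_range] using Submodule.finrank_mono hrange
    _ ≤ Fintype.card l := finrank_range_le_card P.col

theorem rightRank_submatrix_le {m' n' : Type*} [Finite m] [Finite n] [Finite m'] [Finite n']
    (M : Matrix m n K) (f : m' → m) (g : n' → n) : rightRank (M.submatrix f g) ≤ rightRank M := by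
  obtain ⟨P, Q, h⟩ := exists_rank_factorization M
  calc rightRank (M.submatrix f g) = rightRank (P.submatrix f id * Q.submatrix id g) := by
        conv_lhs => rw [h, Matrix.submatrix_mul P Q f id g Function.bijective_id]
    _ ≤ rightRank M := by simpa using rightRank_mul_le_card (P.submatrix f id) (Q.submatrix id g)

theorem rightRank_submatrix_equiv {m' n' : Type*} [Finite m] [Finite n] [Finite m'] [Finite n']
    (M : Matrix m n K) (e : m' ≃ m) (f : n' ≃ n) : rightRank (M.submatrix e f) = rightRank M :=
  (rightRank_submatrix_le M e f).antisymm <| by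
    simpa using rightRank_submatrix_le (M.submatrix e f) e.symm f.symm

theorem rightRank_conjTranspose_le [StarRing K] [Finite m] [Finite n] (M : Matrix m n K) :
    rightRank Mᴴ ≤ rightRank M := by
  obtain ⟨P, Q, h⟩ := exists_rank_factorization M
  calc rightRank Mᴴ = rightRank (Qᴴ * Pᴴ) := by rw [← Matrix.conjTranspose_mul, ← h]
    _ ≤ rightRank M := by simpa using rightRank_mul_le_card Qᴴ Pᴴ

theorem rightRank_conjTranspose [StarRing K] [Finite m] [Finite n] (M : Matrix m n K) :
    rightRank Mᴴ = rightRank M :=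
  (rightRank_conjTranspose_le M).antisymm (by simpa using rightRank_conjTranspose_le Mᴴ)

end Rank

section BlockMatrices

open Finset Matrix

variable {K ι κ : Type*} {d : ι → Type*} {e : κ → Type*} {I : Finset ι} {J : Finset κ}

/-- The vector with blocks `x i` for `i ∈ I`. -/
def blockVec (I : Finset ι) (x : ∀ i, d i → K) : (Σ i : I, d i) → K :=
  fun y => x y.1 y.2

/-- The matrix with blocks `M i j` for `i ∈ I` and `j ∈ J`. -/
def blockMatrix (M : ∀ i j, Matrix (d i) (e j) K) (I : Finset ι) (J : Finset κ) :
    Matrix (Σ i : I, d i) (Σ j : J, e j) K :=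
  Matrix.of fun x y => M x.1 y.1 x.2 y.2

theorem blockVec_eq_iff {x y : ∀ i, d i → K} :
    blockVec I x = blockVec I y ↔ ∀ i ∈ I, x i = y i :=
  ⟨fun h i hi => funext fun a => congrFun h ⟨⟨i, hi⟩, a⟩,
    fun h => funext fun y => congrFun (h y.1 y.1.2) y.2⟩

theorem exists_blockVec_eq [Zero K] (w : (Σ i : I, d i) → K) :
    ∃ x, (∀ i ∉ I, x i = 0) ∧ blockVec I x = w := by
  classical
  exact ⟨fun i a => if hi : i ∈ I then w ⟨⟨i, hi⟩, a⟩ else 0, fun i hi => by simp [hi]; rfl,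
    funext fun y => by simp [blockVec]⟩

theorem blockMatrix_mulVec_blockVec [NonUnitalNonAssocSemiring K] [Fintype κ] [∀ j, Fintype (e j)]
    (M : ∀ i j, Matrix (d i) (e j) K) {v : ∀ j, e j → K} (hv : ∀ j ∉ J, v j = 0) :
    blockMatrix M I J *ᵥ blockVec J v = blockVec I fun i => ∑ j, M i j *ᵥ v j := by
  ext ⟨i, a⟩
  calc (blockMatrix M I J *ᵥ blockVec J v) ⟨i, a⟩
      = ∑ j : J, (M i j *ᵥ v j) a := Fintype.sum_sigma _
    _ = ∑ j ∈ J, (M i j *ᵥ v j) a := J.sum_coe_sort fun j => (M i j *ᵥ v j) a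
    _ = ∑ j, (M i j *ᵥ v j) a := sum_subset J.subset_univ fun j _ hj => by simp [hv j hj]
    _ = (∑ j, M i j *ᵥ v j) a := (Finset.sum_apply a _ _).symm

theorem blockDiagonal'_mulVec_apply [NonUnitalNonAssocSemiring K] [Fintype ι] [DecidableEq ι]
    [∀ i, Fintype (d i)] {d' : ι → Type*} (M : ∀ i, Matrix (d' i) (d i) K) (v : (Σ i, d i) → K)
    (i : ι) (a : d' i) : (blockDiagonal' M *ᵥ v) ⟨i, a⟩ = (M i *ᵥ fun b => v ⟨i, b⟩) a := by
  refine (Fintype.sum_sigma _).trans ((Fintype.sum_eq_single i fun j hj => ?_).trans ?_)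
  · simp [blockDiagonal'_apply_ne _ _ _ hj.symm]
  · simp [mulVec, dotProduct]

end BlockMatrices

section Bidiagonal

open Finset Matrix

theorem sum_single_castSucc {k : ℕ} {V : Fin (k + 1) → Type*} [∀ j, AddCommMonoid (V j)]
    (f : ∀ i : Fin k, V i.castSucc) :
    ∑ i, Pi.single i.castSucc (f i) = Fin.snoc (α := V) f 0 := by
  ext j
  rw [Finset.sum_apply]
  induction j using Fin.lastCases with
  | last => simp
  | cast i =>
    rw [Fintype.sum_eq_single i fun i' hi' =>
      Pi.single_eq_of_ne ((Fin.castSucc_injective k).ne hi'.symm) _]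
    simp

theorem sum_single_succ {k : ℕ} {V : Fin (k + 1) → Type*} [∀ j, AddCommMonoid (V j)]
    (g : ∀ i : Fin k, V i.succ) :
    ∑ i, Pi.single i.succ (g i) = Fin.cons (α := V) 0 g := by
  ext j
  rw [Finset.sum_apply]
  induction j using Fin.cases with
  | zero => simp
  | succ i =>
    rw [Fintype.sum_eq_single i fun i' hi' =>
      Pi.single_eq_of_ne ((Fin.succ_injective k).ne hi'.symm) _]
    simp

variable {K : Type*} [DivisionRing K] {k : ℕ} {p : Fin k → Type*} {s : Fin (k + 1) → Type*}

/-- Block row `i` of a block bidiagonal matrix: `A i` in block column `i`, `C i` in block column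
`i + 1`, and zeros elsewhere. -/
def bidiagRow (A : ∀ i : Fin k, Matrix (p i) (s i.castSucc) K)
    (C : ∀ i : Fin k, Matrix (p i) (s i.succ) K) (i : Fin k) :
    ∀ j : Fin (k + 1), Matrix (p i) (s j) K :=
  Pi.single i.castSucc (A i) + Pi.single i.succ (C i)

/-- The part of the block bidiagonal matrix with block rows in `I` and block columns in `J`, which
is `bidiag` over any division ring. -/
def blockBidiag (A : ∀ i : Fin k, Matrix (p i) (s i.castSucc) K)
    (C : ∀ i : Fin k, Matrix (p i) (s i.succ) K) (I : Finset (Fin k)) (J : Finset (Fin (k + 1))) :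
    Matrix (Σ i : I, p i) (Σ j : J, s j) K :=
  blockMatrix (bidiagRow A C) I J

/-- The block diagonal matrix `diag(E_m, -E_{m+1}, …, (-1)^{n-m} E_n)`. The exponent `m + i` has the
parity of `i - m`. -/
def alternatingDiag (E : ∀ i : Fin k, Matrix (p i) (p i) K) (m n : Fin k) :
    Matrix (Σ i : Icc m n, p i) (Σ i : Icc m n, p i) K :=
  blockDiagonal' fun i : Icc m n => (-1 : ℤ) ^ ((m : ℕ) + i.1) • E i

variable {A : ∀ i : Fin k, Matrix (p i) (s i.castSucc) K}
  {C : ∀ i : Fin k, Matrix (p i) (s i.succ) K} {E : ∀ i : Fin k, Matrix (p i) (p i) K}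

theorem blockBidiag_mulVec_blockVec [∀ j, Fintype (s j)] (I : Finset (Fin k))
    {J : Finset (Fin (k + 1))} {v : ∀ j, s j → K} (hv : ∀ j ∉ J, v j = 0) :
    blockBidiag A C I J *ᵥ blockVec J v =
      blockVec I fun i => A i *ᵥ v i.castSucc + C i *ᵥ v i.succ := by
  refine (blockMatrix_mulVec_blockVec _ hv).trans (congrArg _ (funext fun i => ?_))
  simp only [bidiagRow, Pi.add_apply, add_mulVec, sum_add_distrib]
  congr 1
  · rw [Fintype.sum_eq_single i.castSucc fun j hj => by simp [hj], Pi.single_eq_same]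
  · rw [Fintype.sum_eq_single i.succ fun j hj => by simp [hj], Pi.single_eq_same]

theorem alternatingDiag_mulVec_blockVec [∀ i, Fintype (p i)] (m n : Fin k) (x : ∀ i, p i → K) :
    alternatingDiag E m n *ᵥ blockVec (Icc m n) (fun i => (-1 : ℤ) ^ ((m : ℕ) + i) • x i) =
      blockVec (Icc m n) fun i => E i *ᵥ x i := by
  ext ⟨i, a⟩
  calc (alternatingDiag E m n *ᵥ blockVec _ fun i => (-1 : ℤ) ^ ((m : ℕ) + i) • x i) ⟨i, a⟩
      = (((-1 : ℤ) ^ ((m : ℕ) + i.1) • E i) *ᵥ ((-1 : ℤ) ^ ((m : ℕ) + i.1) • x i)) a :=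
        blockDiagonal'_mulVec_apply (fun i : Icc m n => (-1 : ℤ) ^ ((m : ℕ) + i.1) • E i) _ i a
    _ = (E i *ᵥ x i) a := by
        rw [smul_mulVec, mulVec_smul, smul_smul, ← mul_pow, neg_one_mul, neg_neg, one_pow, one_smul]

variable [StarRing K] [∀ i, Fintype (p i)]

theorem conjTranspose_blockBidiag_mulVec_blockVec {I : Finset (Fin k)}
    (J : Finset (Fin (k + 1))) {x : ∀ i, p i → K} (hx : ∀ i ∉ I, x i = 0) :
    (blockBidiag A C I J)ᴴ *ᵥ blockVec I x = blockVec J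
      (Fin.snoc (α := fun j => s j → K) (fun i => (A i)ᴴ *ᵥ x i) 0 +
        Fin.cons (α := fun j => s j → K) 0 (fun i => (C i)ᴴ *ᵥ x i)) := by
  refine (blockMatrix_mulVec_blockVec (fun j i => (bidiagRow A C i j)ᴴ) hx).trans
    (congrArg _ (funext fun j => ?_))
  rw [← sum_single_castSucc, ← sum_single_succ]
  simp only [bidiagRow, Pi.add_apply, conjTranspose_add, add_mulVec, sum_add_distrib,
    Finset.sum_apply]
  congr! 3 with i _ i _
  · exact Pi.apply_single (fun j (M : Matrix (p i) (s j) K) => Mᴴ *ᵥ x i) (by simp) _ _ _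
  · exact Pi.apply_single (fun j (M : Matrix (p i) (s j) K) => Mᴴ *ᵥ x i) (by simp) _ _ _

theorem conjTranspose_blockBidiag_mulVec_blockVec_eq_zero_iff {m n : Fin k}
    {J : Finset (Fin (k + 1))} {x : ∀ i, p i → K} (hx : ∀ i ∉ Icc m n, x i = 0) :
    (blockBidiag A C (Icc m n) J)ᴴ *ᵥ
        blockVec (Icc m n) (fun i => (-1 : ℤ) ^ ((m : ℕ) + i) • x i) = 0 ↔
      ∀ j ∈ J, Fin.snoc (α := fun j => s j → K) (fun i => (A i)ᴴ *ᵥ x i) 0 j =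
        Fin.cons (α := fun j => s j → K) 0 (fun i => (C i)ᴴ *ᵥ x i) j := by
  have hsnoc : ∀ j : Fin (k + 1), Fin.snoc (α := fun j => s j → K)
      (fun i => (A i)ᴴ *ᵥ ((-1 : ℤ) ^ ((m : ℕ) + i) • x i)) 0 j = (-1 : ℤ) ^ ((m : ℕ) + j) •
        Fin.snoc (α := fun j => s j → K) (fun i => (A i)ᴴ *ᵥ x i) 0 j := by
    intro j
    induction j using Fin.lastCases <;> simp [mulVec_smul, -zsmul_eq_mul]
  have hcons : ∀ j : Fin (k + 1), Fin.cons (α := fun j => s j → K) 0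
      (fun i => (C i)ᴴ *ᵥ ((-1 : ℤ) ^ ((m : ℕ) + i) • x i)) j = -((-1 : ℤ) ^ ((m : ℕ) + j) •
        Fin.cons (α := fun j => s j → K) 0 (fun i => (C i)ᴴ *ᵥ x i) j) := by
    intro j
    induction j using Fin.cases <;> simp [mulVec_smul, ← add_assoc, pow_succ, -zsmul_eq_mul]
  rw [conjTranspose_blockBidiag_mulVec_blockVec _ fun i hi => by rw [hx i hi, smul_zero],
    show (0 : (Σ j : J, s j) → K) = blockVec J 0 from rfl, blockVec_eq_iff]
  have hsign : ∀ j : Fin (k + 1), ∀ a b : s j → K,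
      (-1 : ℤ) ^ ((m : ℕ) + j) • a + -((-1 : ℤ) ^ ((m : ℕ) + j) • b) = 0 ↔ a = b := by
    intro j a b
    rw [← sub_eq_add_neg, ← smul_sub, ← sub_eq_zero (a := a)]
    obtain h | h := neg_one_pow_eq_or ℤ ((m : ℕ) + j) <;> simp [h, -zsmul_eq_mul, -neg_sub]
  refine forall₂_congr fun j _ => ?_
  rw [Pi.add_apply, hsnoc, hcons]
  exact hsign j _ _

end Bidiagonal

section Staircase

open Finset Matrix

variable {k : ℕ}

/-- The nodes of the segment of the chain that consists of the edges `m, …, n`; the first node `m`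
and the last node `n + 1` belong to it if `a`, respectively `b`, is true. -/
def nodes (m n : Fin k) (a b : Bool) : Finset (Fin (k + 1)) :=
  Icc (bif a then m.castSucc else m.succ) (bif b then n.succ else n.castSucc)

theorem mem_nodes {m n : Fin k} {a b : Bool} {j : Fin (k + 1)} :
    j ∈ nodes m n a b ↔ j ∈ Icc m.castSucc n.succ ∧
      (a = false → j ≠ m.castSucc) ∧ (b = false → j ≠ n.succ) := by
  cases a <;> cases b <;> simp only [nodes, mem_Icc, Fin.le_def, Fin.ext_iff, Fin.val_castSucc,
    Fin.val_succ, cond_true, cond_false, ne_eq, eq_self, reduceCtorEq, false_imp_iff,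
    true_imp_iff, and_true, true_and] <;> omega

theorem snoc_zero_succ {V : Fin (k + 1) → Type*} [∀ j, Zero (V j)] {m n : Fin k}
    {f : ∀ i : Fin k, V i.castSucc} (hf : ∀ i ∉ Icc m n, f i = 0) :
    Fin.snoc (α := V) f 0 n.succ = 0 := by
  obtain ⟨i, hi⟩ | hlast := n.succ.eq_castSucc_or_eq_last
  · rw [hi, Fin.snoc_castSucc, hf i fun h => ?_]
    exact (Fin.castSucc_le_castSucc_iff.2 (mem_Icc.1 h).2).not_gt (hi ▸ n.castSucc_lt_succ)
  · rw [hlast, Fin.snoc_last]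

theorem cons_zero_castSucc {V : Fin (k + 1) → Type*} [∀ j, Zero (V j)] {m n : Fin k}
    {g : ∀ i : Fin k, V i.succ} (hg : ∀ i ∉ Icc m n, g i = 0) :
    Fin.cons (α := V) 0 g m.castSucc = 0 := by
  obtain hzero | ⟨i, hi⟩ := m.castSucc.eq_zero_or_eq_succ
  · rw [hzero, Fin.cons_zero]
  · rw [hi, Fin.cons_succ, hg i fun h => ?_]
    exact (Fin.succ_le_succ_iff.2 (mem_Icc.1 h).1).not_gt (hi ▸ m.castSucc_lt_succ)

theorem forall_mem_nodes_eq_iff {V : Fin (k + 1) → Type*} [∀ j, Zero (V j)] {m n : Fin k}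
    (hmn : m ≤ n) {a b : Bool} {α γ : ∀ j, V j} (hα : α n.succ = 0) (hγ : γ m.castSucc = 0) :
    (∀ j ∈ nodes m n (!a) (!b), α j = γ j) ↔
      ∃ z : ∀ j, V j, (∀ i ∈ Icc m n, α i.castSucc = z i.castSucc ∧ γ i.succ = z i.succ) ∧
        (a = false → z m.castSucc = 0) ∧ (b = false → z n.succ = 0) := by
  have hlt : m.castSucc < n.succ := Fin.castSucc_lt_succ_iff.2 hmn
  simp only [mem_nodes, mem_Icc, Bool.not_eq_false']
  constructor
  · intro h
    let z : ∀ j, V j := fun j => if j = n.succ then γ j else α j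
    have hzα : ∀ j ≠ n.succ, z j = α j := fun j hj => if_neg hj
    have hzγ : z n.succ = γ n.succ := if_pos rfl
    refine ⟨z, fun i hi => ⟨(hzα _ (Fin.castSucc_lt_succ_iff.2 hi.2).ne).symm, ?_⟩, fun ha => ?_,
      fun hb => ?_⟩
    · have hmi : m.castSucc < i.succ := Fin.castSucc_lt_succ_iff.2 hi.1
      obtain hin | hin := eq_or_ne i.succ n.succ
      · rw [hin, hzγ]
      · rw [hzα _ hin, h i.succ
          ⟨⟨hmi.le, Fin.succ_le_succ_iff.2 hi.2⟩, fun _ => hmi.ne', fun _ => hin⟩]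
    · rw [hzα _ hlt.ne, h m.castSucc ⟨⟨le_rfl, hlt.le⟩, by simp [ha], fun _ => hlt.ne⟩, hγ]
    · rw [hzγ, ← h n.succ ⟨⟨hlt.le, le_rfl⟩, fun _ => hlt.ne', by simp [hb]⟩, hα]
  · rintro ⟨z, hz, ha, hb⟩ j ⟨hj, hja, hjb⟩
    have hαz : j ≠ n.succ → α j = z j := fun hjn => by
      obtain ⟨i, rfl⟩ := Fin.exists_castSucc_eq.2 ((hj.2.lt_of_ne hjn).trans_le n.succ.le_last).ne
      exact (hz i ⟨Fin.castSucc_le_castSucc_iff.1 hj.1,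
        Fin.castSucc_lt_succ_iff.1 (hj.2.lt_of_ne hjn)⟩).1
    have hγz : j ≠ m.castSucc → γ j = z j := fun hjm => by
      have hmj := hj.1.lt_of_ne' hjm
      obtain ⟨i, rfl⟩ := Fin.exists_succ_eq.2 ((Fin.zero_le _).trans_lt hmj).ne'
      exact (hz i ⟨Fin.castSucc_lt_succ_iff.1 hmj, Fin.succ_le_succ_iff.1 hj.2⟩).2
    obtain rfl | hjm := eq_or_ne j m.castSucc
    · rw [hαz hlt.ne, ha (by simpa using hja), hγ]
    obtain rfl | hjn := eq_or_ne j n.succ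
    · rw [hγz hjm, hb (by simpa using hjb), hα]
    rw [hαz hjn, hγz hjm]

theorem forall_mem_nodes_snoc_eq_cons_iff {V : Fin (k + 1) → Type*} [∀ j, Zero (V j)]
    {m n : Fin k} (hmn : m ≤ n) {a b : Bool} {f : ∀ i : Fin k, V i.castSucc}
    {g : ∀ i : Fin k, V i.succ} (hf : ∀ i ∉ Icc m n, f i = 0) (hg : ∀ i ∉ Icc m n, g i = 0) :
    (∀ j ∈ nodes m n (!a) (!b), Fin.snoc (α := V) f 0 j = Fin.cons (α := V) 0 g j) ↔
      ∃ z : ∀ j, V j, (∀ i ∈ Icc m n, f i = z i.castSucc ∧ g i = z i.succ) ∧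
        (a = false → z m.castSucc = 0) ∧ (b = false → z n.succ = 0) := by
  simpa only [Fin.snoc_castSucc, Fin.cons_succ] using
    forall_mem_nodes_eq_iff hmn (snoc_zero_succ hf) (cons_zero_castSucc hg)

theorem exists_eq_zero_off_nodes_iff {V : Fin (k + 1) → Type*} [∀ j, Zero (V j)] {m n : Fin k}
    {a b : Bool} (Q : ∀ i : Fin k, V i.castSucc → V i.succ → Prop) :
    (∃ v : ∀ j, V j, (∀ j ∉ nodes m n a b, v j = 0) ∧
        ∀ i ∈ Icc m n, Q i (v i.castSucc) (v i.succ)) ↔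
      ∃ v : ∀ j, V j, (a = false → v m.castSucc = 0) ∧ (b = false → v n.succ = 0) ∧
        ∀ i ∈ Icc m n, Q i (v i.castSucc) (v i.succ) := by
  constructor
  · rintro ⟨v, hv, hQ⟩
    exact ⟨v, fun ha => hv _ (by simp [mem_nodes, ha]), fun hb => hv _ (by simp [mem_nodes, hb]),
      hQ⟩
  · rintro ⟨v, ha, hb, hQ⟩
    let v' : ∀ j, V j := fun j => if j ∈ nodes m n a b then v j else 0
    have hv' : ∀ j ∈ Icc m.castSucc n.succ, v' j = v j := by
      intro j hj
      by_cases hjn : j ∈ nodes m n a b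
      · exact if_pos hjn
      · refine (if_neg hjn).trans ?_
        simp only [mem_nodes, hj, true_and, not_and_or, Classical.not_imp, not_not] at hjn
        obtain ⟨h, rfl⟩ | ⟨h, rfl⟩ := hjn
        exacts [(ha h).symm, (hb h).symm]
    refine ⟨v', fun j hj => if_neg hj, fun i hi => ?_⟩
    rw [mem_Icc] at hi
    rw [hv' _ (mem_Icc.2
        ⟨Fin.castSucc_le_castSucc_iff.2 hi.1, (Fin.castSucc_lt_succ_iff.2 hi.2).le⟩),
      hv' _ (mem_Icc.2 ⟨(Fin.castSucc_lt_succ_iff.2 hi.1).le, Fin.succ_le_succ_iff.2 hi.2⟩)]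
    exact hQ i (mem_Icc.2 hi)

variable {K : Type*} [DivisionRing K] [StarRing K] {p : Fin k → Type*} {s : Fin (k + 1) → Type*}

/-- The matrix which for `m ≤ i ≤ n` has `A i`, `± E i`, `C i` in one block row, as far as the
block columns of `A i` and `C i` are in `J`, and below `± E i` the blocks `(A i)ᴴ` and `(C i)ᴴ`, as
far as their block rows are in `J'`: this is `staircase` over any division ring with involution. -/
def staircaseMatrix (A : ∀ i : Fin k, Matrix (p i) (s i.castSucc) K)
    (C : ∀ i : Fin k, Matrix (p i) (s i.succ) K) (E : ∀ i : Fin k, Matrix (p i) (p i) K)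
    (m n : Fin k) (J J' : Finset (Fin (k + 1))) :
    Matrix ((Σ i : Icc m n, p i) ⊕ (Σ j : J', s j)) ((Σ j : J, s j) ⊕ (Σ i : Icc m n, p i)) K :=
  fromBlocks (blockBidiag A C (Icc m n) J) (alternatingDiag E m n)
    0 (blockBidiag A C (Icc m n) J')ᴴ

variable {A : ∀ i : Fin k, Matrix (p i) (s i.castSucc) K}
  {C : ∀ i : Fin k, Matrix (p i) (s i.succ) K} {E : ∀ i : Fin k, Matrix (p i) (p i) K} {m n : Fin k}

theorem alternatingDiag_conjTranspose (hE : ∀ i, (E i).IsHermitian) :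
    (alternatingDiag E m n)ᴴ = alternatingDiag E m n := by
  rw [alternatingDiag, blockDiagonal'_conjTranspose]
  simp only [conjTranspose_zsmul, (hE _).eq]

theorem rightRank_staircaseMatrix_comm [∀ i, Finite (p i)] [∀ j, Finite (s j)]
    (hE : ∀ i, (E i).IsHermitian) (J J' : Finset (Fin (k + 1))) :
    rightRank (staircaseMatrix A C E m n J J') = rightRank (staircaseMatrix A C E m n J' J) := by
  have hswap : (staircaseMatrix A C E m n J J')ᴴ =
      (staircaseMatrix A C E m n J' J).submatrix (Equiv.sumComm _ _) (Equiv.sumComm _ _) := by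
    simp [staircaseMatrix, fromBlocks_conjTranspose, alternatingDiag_conjTranspose hE]
  rw [← rightRank_conjTranspose, hswap, rightRank_submatrix_equiv]

variable [∀ i, Fintype (p i)] [∀ j, Fintype (s j)]

theorem rightRank_staircaseMatrix_eq_add_iff {J J' : Finset (Fin (k + 1))} :
    rightRank (staircaseMatrix A C E m n J J') =
        rightRank (blockBidiag A C (Icc m n) J) + rightRank (blockBidiag A C (Icc m n) J') ↔
      ∀ x : ∀ i, p i → K, (∀ i ∉ Icc m n, x i = 0) →
        (∀ j ∈ J', Fin.snoc (α := fun j => s j → K) (fun i => (A i)ᴴ *ᵥ x i) 0 j =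
          Fin.cons (α := fun j => s j → K) 0 (fun i => (C i)ᴴ *ᵥ x i) j) →
        ∃ v : ∀ j, s j → K, (∀ j ∉ J, v j = 0) ∧
          ∀ i ∈ Icc m n, E i *ᵥ x i = A i *ᵥ v i.castSucc + C i *ᵥ v i.succ := by
  rw [← rightRank_conjTranspose (blockBidiag A C (Icc m n) J'), staircaseMatrix,
    rightRank_fromBlocks_eq_iff]
  constructor
  · intro h x hx hJ'
    obtain ⟨w, hw⟩ := h _ ((conjTranspose_blockBidiag_mulVec_blockVec_eq_zero_iff hx).2 hJ')
    obtain ⟨v, hv, rfl⟩ := exists_blockVec_eq w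
    rw [alternatingDiag_mulVec_blockVec, blockBidiag_mulVec_blockVec _ hv, blockVec_eq_iff] at hw
    exact ⟨v, hv, hw⟩
  · intro h y hy
    obtain ⟨x, hx, rfl⟩ : ∃ x : ∀ i, p i → K, (∀ i ∉ Icc m n, x i = 0) ∧
        blockVec (Icc m n) (fun i => (-1 : ℤ) ^ ((m : ℕ) + i) • x i) = y := by
      obtain ⟨x, hx, rfl⟩ := exists_blockVec_eq y
      refine ⟨fun i => (-1 : ℤ) ^ ((m : ℕ) + i) • x i, fun i hi => by simp [hx i hi], ?_⟩
      simp [smul_smul, ← mul_pow, -zsmul_eq_mul]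
    obtain ⟨v, hv, hvE⟩ :=
      h x hx ((conjTranspose_blockBidiag_mulVec_blockVec_eq_zero_iff hx).1 hy)
    refine ⟨blockVec J v, ?_⟩
    rwa [alternatingDiag_mulVec_blockVec, blockBidiag_mulVec_blockVec _ hv, blockVec_eq_iff]

/-- The solvability condition on the equations `m, …, n` of the chain
`A i * X i * (A i)ᴴ + C i * X (i + 1) * (C i)ᴴ = E i`; the end at the unknown `m` (at the unknown
`n + 1`) is free if `a` (if `b`) is true, and held at zero otherwise. -/
def SegmentCondition (A : ∀ i : Fin k, Matrix (p i) (s i.castSucc) K)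
    (C : ∀ i : Fin k, Matrix (p i) (s i.succ) K) (E : ∀ i : Fin k, Matrix (p i) (p i) K)
    (m n : Fin k) (a b : Bool) : Prop :=
  LiftsZigzags (V := fun j => s j → K) (V' := fun j => s j → K) (fun i => colMap (A i))
    (fun i => colMap (C i)) (fun i => colMap (A i)ᴴ) (fun i => colMap (C i)ᴴ)
    (fun i => colMap (E i)) m.castSucc n.succ (endRelation Kᵐᵒᵖ a) (endRelation Kᵐᵒᵖ b)

theorem rightRank_staircaseMatrix_nodes_eq_add_iff (hmn : m ≤ n) (a b : Bool) :
    rightRank (staircaseMatrix A C E m n (nodes m n a b) (nodes m n (!a) (!b))) =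
        rightRank (blockBidiag A C (Icc m n) (nodes m n a b)) +
          rightRank (blockBidiag A C (Icc m n) (nodes m n (!a) (!b))) ↔
      SegmentCondition A C E m n a b := by
  have hedge : ∀ {P : Fin k → Prop},
      (∀ i, m.castSucc ≤ i.castSucc → i.succ ≤ n.succ → P i) ↔ ∀ i ∈ Icc m n, P i := by
    simp
  simp only [rightRank_staircaseMatrix_eq_add_iff, SegmentCondition, LiftsZigzags, hedge,
    mem_endRelation, colMap_apply]
  have hsol : ∀ x : ∀ i, p i → K, _ := fun x =>
    exists_eq_zero_off_nodes_iff (V := fun j => s j → K) (m := m) (n := n) (a := a) (b := b)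
      fun i v w => E i *ᵥ x i = A i *ᵥ v + C i *ᵥ w
  simp only [hsol]
  constructor
  · rintro h x z hx ⟨_, hl⟩ ⟨_, hr⟩
    let x' : ∀ i, p i → K := fun i => if i ∈ Icc m n then x i else 0
    have hx' : ∀ i ∈ Icc m n, x' i = x i := fun i hi => if_pos hi
    have hx'0 : ∀ i ∉ Icc m n, x' i = 0 := fun i hi => if_neg hi
    obtain ⟨v, hvl, hvr, hv⟩ := h x' hx'0 <| (forall_mem_nodes_snoc_eq_cons_iff hmn
      (fun i hi => by rw [hx'0 i hi, mulVec_zero]) fun i hi => by rw [hx'0 i hi, mulVec_zero]).2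
      ⟨z, fun i hi => (hx' i hi).symm ▸ hx i hi, fun ha => (hl ha).1, fun hb => (hr hb).1⟩
    exact ⟨v, fun ha => ⟨(hl ha).1, hvl ha⟩, fun hb => ⟨(hr hb).1, hvr hb⟩,
      fun i hi => hx' i hi ▸ hv i hi⟩
  · intro h x hx hJ'
    obtain ⟨z, hz, hzl, hzr⟩ := (forall_mem_nodes_snoc_eq_cons_iff hmn
      (fun i hi => by rw [hx i hi, mulVec_zero]) fun i hi => by rw [hx i hi, mulVec_zero]).1 hJ'
    obtain ⟨v, hvl, hvr, hv⟩ := h x z hz ⟨0, fun ha => ⟨hzl ha, rfl⟩⟩ ⟨0, fun hb => ⟨hzr hb, rfl⟩⟩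
    exact ⟨v, fun ha => (hvl ha).2, fun hb => (hvr hb).2, hv⟩

theorem segmentCondition_not_iff (hmn : m ≤ n) (hE : ∀ i, (E i).IsHermitian) (a b : Bool) :
    SegmentCondition A C E m n (!a) (!b) ↔ SegmentCondition A C E m n a b := by
  rw [← rightRank_staircaseMatrix_nodes_eq_add_iff hmn,
    ← rightRank_staircaseMatrix_nodes_eq_add_iff hmn, Bool.not_not, Bool.not_not,
    rightRank_staircaseMatrix_comm hE, add_comm (rightRank (blockBidiag _ _ _ (nodes m n a b)))]

end Staircase

section HermitianSolution

open Finset Matrix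

theorem two_nsmul_cancel {K V : Type*} [DivisionRing K] [AddCommGroup V] [Module K V]
    (h2 : (2 : K) ≠ 0) {v w : V} (h : 2 • v = 2 • w) : v = w := by
  rwa [← Nat.cast_smul_eq_nsmul K, ← Nat.cast_smul_eq_nsmul K 2 w, Nat.cast_ofNat,
    (IsUnit.mk0 2 h2).smul_left_cancel] at h

theorem forall_lt_iff_forall_castSucc_succ {k : ℕ} {P : Fin (k + 1) → Fin (k + 1) → Prop} :
    (∀ l r, l < r → P l r) ↔ ∀ m n : Fin k, m ≤ n → P m.castSucc n.succ := by
  refine ⟨fun h m n hmn => h _ _ (Fin.castSucc_lt_succ_iff.2 hmn), fun h l r hlr => ?_⟩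
  obtain ⟨m, rfl⟩ := Fin.exists_castSucc_eq.2 (hlr.trans_le (Fin.le_last r)).ne
  obtain ⟨n, rfl⟩ := Fin.exists_succ_eq.2 ((Fin.zero_le _).trans_lt hlr).ne'
  exact h m n (Fin.castSucc_lt_succ_iff.1 hlr)

variable {K : Type*} [DivisionRing K] [StarRing K] {k : ℕ} {p : Fin k → Type*}
  {s : Fin (k + 1) → Type*} [∀ j, Fintype (s j)]
  {A : ∀ i : Fin k, Matrix (p i) (s i.castSucc) K}
  {C : ∀ i : Fin k, Matrix (p i) (s i.succ) K} {E : ∀ i : Fin k, Matrix (p i) (p i) K}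

theorem exists_isHermitian_solution_iff (h2 : (2 : K) ≠ 0) (hE : ∀ i, (E i).IsHermitian) :
    (∃ X : ∀ j, Matrix (s j) (s j) K, (∀ j, (X j).IsHermitian) ∧
      ∀ i, A i * X i.castSucc * (A i)ᴴ + C i * X i.succ * (C i)ᴴ = E i) ↔
    ∃ X : ∀ j, Matrix (s j) (s j) K,
      ∀ i, A i * X i.castSucc * (A i)ᴴ + C i * X i.succ * (C i)ᴴ = E i := by
  refine ⟨fun ⟨X, _, hX⟩ => ⟨X, hX⟩, fun ⟨X, hX⟩ => ?_⟩
  have hX' : ∀ i, A i * (X i.castSucc)ᴴ * (A i)ᴴ + C i * (X i.succ)ᴴ * (C i)ᴴ = E i := fun i => by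
    simpa [Matrix.mul_assoc, (hE i).eq] using congrArg conjTranspose (hX i)
  have hhalf : ∀ j, ∃ Y : Matrix (s j) (s j) K, 2 • Y = X j + (X j)ᴴ := fun j =>
    ⟨(2⁻¹ : K) • (X j + (X j)ᴴ), by
      rw [← Nat.cast_smul_eq_nsmul K, Nat.cast_ofNat, smul_inv_smul₀ h2]⟩
  choose Y hY using hhalf
  refine ⟨Y, fun j => two_nsmul_cancel h2 ?_, fun i => two_nsmul_cancel h2 ?_⟩
  · rw [← conjTranspose_nsmul, hY, conjTranspose_add, conjTranspose_conjTranspose, add_comm]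
  · calc 2 • (A i * Y i.castSucc * (A i)ᴴ + C i * Y i.succ * (C i)ᴴ)
        = A i * (2 • Y i.castSucc) * (A i)ᴴ + C i * (2 • Y i.succ) * (C i)ᴴ := by
          simp only [smul_add, Matrix.mul_smul, Matrix.smul_mul]
      _ = (A i * X i.castSucc * (A i)ᴴ + C i * X i.succ * (C i)ᴴ) +
            (A i * (X i.castSucc)ᴴ * (A i)ᴴ + C i * (X i.succ)ᴴ * (C i)ᴴ) := by
          simp only [hY, Matrix.mul_add, Matrix.add_mul]
          abel
      _ = 2 • E i := by rw [hX, hX', two_nsmul]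

theorem exists_solution_iff_segmentCondition [∀ i, Fintype (p i)] :
    (∃ X : ∀ j, Matrix (s j) (s j) K,
      ∀ i, A i * X i.castSucc * (A i)ᴴ + C i * X i.succ * (C i)ᴴ = E i) ↔
    ∀ m n : Fin k, m ≤ n → ∀ a b, SegmentCondition A C E m n a b := by
  have hcolMap : ∀ X : ∀ j, Matrix (s j) (s j) K,
      (∀ i, A i * X i.castSucc * (A i)ᴴ + C i * X i.succ * (C i)ᴴ = E i) ↔
      ∀ i, colMap (A i) ∘ₗ colMap (X i.castSucc) ∘ₗ colMap (A i)ᴴ +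
        colMap (C i) ∘ₗ colMap (X i.succ) ∘ₗ colMap (C i)ᴴ = colMap (E i) := by
    refine fun X => forall_congr' fun i => ?_
    rw [LinearMap.ext_iff, ← mulVec_injective.eq_iff, funext_iff]
    simp [add_mulVec, ← mulVec_mulVec]
  have hsegment := exists_zigzag_solution_iff (A := fun i => colMap (A i))
    (C := fun i => colMap (C i)) (B := fun i => colMap (A i)ᴴ) (D := fun i => colMap (C i)ᴴ)
    (E := fun i => colMap (E i)) (V := fun j => s j → K) (V' := fun j => s j → K)
  rw [forall_lt_iff_forall_castSucc_succ] at hsegment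
  refine Iff.trans ?_ hsegment
  simp only [hcolMap]
  refine ⟨fun ⟨X, hX⟩ => ⟨fun j => colMap (X j), hX⟩, fun ⟨f, hf⟩ => ?_⟩
  choose X hX using fun j => exists_colMap_eq (f j)
  exact ⟨X, by simpa only [hX] using hf⟩

theorem rightRank_fromCols_eq_iff_segmentCondition [∀ i, Fintype (p i)] (i : Fin k) :
    rightRank (fromCols (A i) (fromCols (E i) (C i))) = rightRank (fromCols (A i) (C i)) ↔
      SegmentCondition A C E i i true true := by
  rw [SegmentCondition, liftsZigzags_castSucc_succ_iff, rightRank_fromCols_fromCols_eq_iff]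
  simp

theorem rightRank_fromBlocks_eq_iff_segmentCondition [∀ i, Fintype (p i)] (i : Fin k) :
    rightRank (fromBlocks (A i) (E i) 0 (C i)ᴴ) = rightRank (A i) + rightRank (C i) ↔
      SegmentCondition A C E i i true false := by
  rw [SegmentCondition, liftsZigzags_castSucc_succ_iff, ← rightRank_conjTranspose (C i),
    rightRank_fromBlocks_eq_iff]
  simp +contextual

theorem forall_segmentCondition_iff [∀ i, Fintype (p i)] (hE : ∀ i, (E i).IsHermitian)
    {m n : Fin k} (hmn : m ≤ n) :
    (∀ a b, SegmentCondition A C E m n a b) ↔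
      SegmentCondition A C E m n true true ∧ SegmentCondition A C E m n true false := by
  have hfalse : ∀ b, SegmentCondition A C E m n false b ↔ SegmentCondition A C E m n true (!b) :=
    fun b => (segmentCondition_not_iff hmn hE false b).symm
  simp only [Bool.forall_bool, hfalse, Bool.not_true, Bool.not_false]
  tauto

theorem theorem4p2_general [∀ i, Finite (p i)] (h2 : (2 : K) ≠ 0)
    (hE : ∀ i, (E i).IsHermitian) :
    (∃ X : ∀ j, Matrix (s j) (s j) K, (∀ j, (X j).IsHermitian) ∧
      ∀ i, A i * X i.castSucc * (A i)ᴴ + C i * X i.succ * (C i)ᴴ = E i) ↔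
    ((∀ i,
        rightRank (fromCols (A i) (fromCols (E i) (C i))) = rightRank (fromCols (A i) (C i)) ∧
        rightRank (fromBlocks (A i) (E i) 0 (C i)ᴴ) = rightRank (A i) + rightRank (C i)) ∧
      ∀ m n : Fin k, m < n →
        rightRank (staircaseMatrix A C E m n
            (Icc m.castSucc n.succ) (Icc m.succ n.castSucc)) =
          rightRank (blockBidiag A C (Icc m n) (Icc m.castSucc n.succ)) +
            rightRank (blockBidiag A C (Icc m n) (Icc m.succ n.castSucc)) ∧
        rightRank (staircaseMatrix A C E m n
            (Icc m.castSucc n.castSucc) (Icc m.succ n.succ)) =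
          rightRank (blockBidiag A C (Icc m n) (Icc m.castSucc n.castSucc)) +
            rightRank (blockBidiag A C (Icc m n) (Icc m.succ n.succ))) := by
  have := fun i => Fintype.ofFinite (p i)
  rw [exists_isHermitian_solution_iff h2 hE, exists_solution_iff_segmentCondition]
  have hstaircase : ∀ {m n : Fin k}, m < n → ∀ b, _ := fun hmn b =>
    rightRank_staircaseMatrix_nodes_eq_add_iff (A := A) (C := C) (E := E) (le_of_lt hmn) true b
  simp only [rightRank_fromCols_eq_iff_segmentCondition,
    rightRank_fromBlocks_eq_iff_segmentCondition]
  constructor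
  · intro h
    exact ⟨fun i => ⟨h i i le_rfl true true, h i i le_rfl true false⟩, fun m n hmn =>
      ⟨(hstaircase hmn true).2 (h m n hmn.le _ _), (hstaircase hmn false).2 (h m n hmn.le _ _)⟩⟩
  · rintro ⟨hdiag, hoff⟩ m n hmn
    rw [forall_segmentCondition_iff hE hmn]
    obtain rfl | hlt := hmn.eq_or_lt
    · exact hdiag m
    · exact (hoff m n hlt).imp (hstaircase hlt true).1 (hstaircase hlt false).1

end HermitianSolution

section Quaternion

open Matrix

variable {η : ℍ[ℝ]}

theorem quatUnit_mul_self (hη : η = quatI ∨ η = quatJ ∨ η = quatK) : η * η = -1 := by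
  obtain rfl | rfl | rfl := hη <;> apply Quaternion.ext <;> simp <;> simp [quatI, quatJ, quatK]

theorem star_quatUnit (hη : η = quatI ∨ η = quatJ ∨ η = quatK) : star η = -η := by
  obtain rfl | rfl | rfl := hη <;> apply Quaternion.ext <;> simp <;> simp [quatI, quatJ, quatK]

/-- The involution `q ↦ -η q* η` of the quaternions, for which `M^{η*}` is the conjugate transpose
of `M`. -/
noncomputable abbrev etaStarRing (hη : η = quatI ∨ η = quatJ ∨ η = quatK) : StarRing ℍ[ℝ] where
  star q := -η * star q * η
  star_involutive q := by
    calc -η * star (-η * star q * η) * η = (η * η) * q * (η * η) := by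
          simp only [star_mul, star_neg, star_star, star_quatUnit hη]
          noncomm_ring
      _ = q := by simp [quatUnit_mul_self hη]
  star_mul q q' := by
    calc -η * star (q * q') * η = -η * star q' * -(-1) * star q * η := by
          rw [star_mul, neg_neg, mul_one, mul_assoc (-η) (star q')]
      _ = (-η * star q' * η) * (-η * star q * η) := by
          rw [← quatUnit_mul_self hη]
          noncomm_ring
  star_add q q' := by simp only [star_add, mul_add, add_mul]

theorem isEtaHermitian_iff_isHermitian (hη : η = quatI ∨ η = quatJ ∨ η = quatK) {n : Type*}
    (M : Matrix n n ℍ[ℝ]) :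
    IsEtaHermitian η M ↔ @Matrix.IsHermitian _ _ (etaStarRing hη).toStar M :=
  eq_comm

variable {k : ℕ} {p : Fin k → ℕ} {s : Fin (k + 1) → ℕ}

theorem bidiagBlock_eq_bidiagRow (A : ∀ i : Fin k, Matrix (Fin (p i)) (Fin (s i.castSucc)) ℍ[ℝ])
    (C : ∀ i : Fin k, Matrix (Fin (p i)) (Fin (s i.succ)) ℍ[ℝ]) (i : Fin k) :
    bidiagBlock A C i = bidiagRow (s := fun j => Fin (s j)) A C i := by
  ext1 j
  obtain rfl | hcast := eq_or_ne j i.castSucc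
  · simp [bidiagBlock, bidiagRow, i.castSucc_lt_succ.ne]
  obtain rfl | hsucc := eq_or_ne j i.succ
  · simp [bidiagBlock, bidiagRow, hcast]
  · simp [bidiagBlock, bidiagRow, hcast, hsucc]

theorem bidiag_eq_blockBidiag (A : ∀ i : Fin k, Matrix (Fin (p i)) (Fin (s i.castSucc)) ℍ[ℝ])
    (C : ∀ i : Fin k, Matrix (Fin (p i)) (Fin (s i.succ)) ℍ[ℝ]) (I : Finset (Fin k))
    (J : Finset (Fin (k + 1))) :
    bidiag A C I J = blockBidiag (s := fun j => Fin (s j)) A C I J := by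
  ext1 x y
  exact congrFun₂ (congrFun (bidiagBlock_eq_bidiagRow A C x.1) y.1) x.2 y.2

theorem signedDiag_eq_alternatingDiag (E : ∀ i : Fin k, Matrix (Fin (p i)) (Fin (p i)) ℍ[ℝ])
    (m n : Fin k) : signedDiag E m n = alternatingDiag E m n := by
  refine congrArg blockDiagonal' (funext fun i => ?_)
  have hsum : (m : ℕ) + i.1 = (i.1 - m : ℕ) + 2 * m := by
    have : (m : ℕ) ≤ i.1 := (Finset.mem_Icc.1 i.2).1
    omega
  rw [hsum, pow_add, pow_mul, neg_one_sq, one_pow, mul_one]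
  obtain h | h := Nat.even_or_odd ((i.1 : ℕ) - m) <;> simp [h.neg_one_pow]

theorem staircase_eq_staircaseMatrix (hη : η = quatI ∨ η = quatJ ∨ η = quatK)
    (A : ∀ i : Fin k, Matrix (Fin (p i)) (Fin (s i.castSucc)) ℍ[ℝ])
    (C : ∀ i : Fin k, Matrix (Fin (p i)) (Fin (s i.succ)) ℍ[ℝ])
    (E : ∀ i : Fin k, Matrix (Fin (p i)) (Fin (p i)) ℍ[ℝ]) (m n : Fin k)
    (J J' : Finset (Fin (k + 1))) :
    letI := etaStarRing hη
    staircase η A C E m n J J' = staircaseMatrix (s := fun j => Fin (s j)) A C E m n J J' := by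
  rw [staircase, bidiag_eq_blockBidiag, bidiag_eq_blockBidiag, signedDiag_eq_alternatingDiag]
  rfl

end Quaternion

theorem theorem4p2 (η : ℍ[ℝ]) (hη : η = quatI ∨ η = quatJ ∨ η = quatK)
    (k : ℕ) (p : Fin k → ℕ) (s : Fin (k + 1) → ℕ)
    (A : ∀ i : Fin k, Matrix (Fin (p i)) (Fin (s i.castSucc)) ℍ[ℝ])
    (C : ∀ i : Fin k, Matrix (Fin (p i)) (Fin (s i.succ)) ℍ[ℝ])
    (E : ∀ i : Fin k, Matrix (Fin (p i)) (Fin (p i)) ℍ[ℝ])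
    (hE : ∀ i, IsEtaHermitian η (E i)) :
    (∃ X : ∀ j : Fin (k + 1), Matrix (Fin (s j)) (Fin (s j)) ℍ[ℝ],
      (∀ j, IsEtaHermitian η (X j)) ∧
      ∀ i : Fin k,
        A i * X i.castSucc * etaStar η (A i) + C i * X i.succ * etaStar η (C i) = E i) ↔
    ((∀ i : Fin k,
        quatRank (Matrix.fromCols (A i) (Matrix.fromCols (E i) (C i))) =
            quatRank (Matrix.fromCols (A i) (C i)) ∧
        quatRank (Matrix.fromBlocks (A i) (E i) 0 (etaStar η (C i))) =
            quatRank (A i) + quatRank (C i)) ∧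
      ∀ m n : Fin k, m < n →
        quatRank (staircase η A C E m n
            (Finset.Icc m.castSucc n.succ) (Finset.Icc m.succ n.castSucc)) =
          quatRank (bidiag A C (Finset.Icc m n) (Finset.Icc m.castSucc n.succ)) +
            quatRank (bidiag A C (Finset.Icc m n) (Finset.Icc m.succ n.castSucc)) ∧
        quatRank (staircase η A C E m n
            (Finset.Icc m.castSucc n.castSucc) (Finset.Icc m.succ n.succ)) =
          quatRank (bidiag A C (Finset.Icc m n) (Finset.Icc m.castSucc n.castSucc)) +
            quatRank (bidiag A C (Finset.Icc m n) (Finset.Icc m.succ n.succ))) := by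
  let := etaStarRing hη
  have h2 : (2 : ℍ[ℝ]) ≠ 0 := fun h => two_ne_zero (congrArg QuaternionAlgebra.re h)
  simp only [isEtaHermitian_iff_isHermitian hη, bidiag_eq_blockBidiag,
    staircase_eq_staircaseMatrix hη] at hE ⊢
  exact theorem4p2_general (s := fun j => Fin (s j)) h2 hE
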